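/- **Proposition 4.2.** Let $M$ be a paracompact Hausdorff space (for instance, a manifold), let $n\ge 0$, and let $E_0\to M$ and $E_1\to M$ be topological $S^{n-1}$-bundles, that is, locally trivial bundles with fiber the unit sphere $S^{n-1}\subset\mathbb{R}^n$ and structure group $\mathrm{Homeo}(S^{n-1})$. Suppose that they are *fiberwise bordant*: there is an $S^{n-1}\times[0,1]$-bundle $E\to M$, with local trivializations whose transition maps preserve each of $S^{n-1}\times\{0\}$ and $S^{n-1}\times\{1\}$, such that for $i=0,1$ the subbundle of $E$ formed by the parts $S^{n-1}\times\{i\}$ of the fibers is isomorphic over $M$ to $E_i\to M$. For $f\in\mathrm{Homeo}(S^{n-1})$ let $\alpha(f)\in\mathrm{Homeo}(\mathbb{R}^n)$ be given by the Alexander trick: $\alpha(f)(0)=0$ and $\alpha(f)(v)=\|v\|\,f(v/\|v\|)$ for $v\neq0$. For $i=0,1$ let $\widehat E_i\to M$ be the $\mathbb{R}^n$-bundle induced from $E_i\to M$ by $\alpha$, that is, the bundle whose transition functions are the images under $\alpha$ of those of $E_i$. Then $\widehat E_0$ and $\widehat E_1$ are stably isomorphic: for some $k\ge0$ there is a homeomorphism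 $\widehat E_0\times\mathbb{R}^k\to\widehat E_1\times\mathbb{R}^k$ that covers the identity of $M$. -/

import Mathlib

open Set Filter Topology Bundle

noncomputable section

/-- `p : E → M` is a topological fiber bundle with fiber `F` (an `F`-bundle): every point of `M`
lies in the base set of a local trivialization. The structure group is all of `Homeo(F)`. -/
def IsTopBundle (F : Type*) [TopologicalSpace F] {M E : Type*} [TopologicalSpace M]
    [TopologicalSpace E] (p : E → M) : Prop :=
  ∀ b : M, ∃ e : Trivialization F p, b ∈ e.baseSet

/-- Two spaces over `M` are isomorphic: there is a homeomorphism of the total spaces that covers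
the identity of `M`. -/
def BundleIso {M E E' : Type*} [TopologicalSpace E] [TopologicalSpace E']
    (p : E → M) (p' : E' → M) : Prop :=
  ∃ h : E ≃ₜ E', ∀ x, p' (h x) = p x

/-- `q : W → M` is a fiberwise bordism between `p₀ : E₀ → M` and `p₁ : E₁ → M`: it is an
`F × [0,1]`-bundle whose local trivializations match up the parts `F × {0}`, and the parts
`F × {1}`, of the fibers (so that these form subspaces `∂₀`, `∂₁` of `W`), and the restriction of
`q` to `∂₀` (to `∂₁`) is a bundle isomorphic to `p₀` (to `p₁`). -/
def IsFiberwiseBordism (F : Type*) [TopologicalSpace F] {M E₀ E₁ W : Type*} [TopologicalSpace M]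
    [TopologicalSpace E₀] [TopologicalSpace E₁] [TopologicalSpace W]
    (p₀ : E₀ → M) (p₁ : E₁ → M) (q : W → M) : Prop :=
  ∃ bd₀ bd₁ : Set W,
    (∀ b : M, ∃ e : Trivialization (F × unitInterval) q, b ∈ e.baseSet ∧
      ∀ w ∈ e.source, (w ∈ bd₀ ↔ (e w).2.2 = 0) ∧ (w ∈ bd₁ ↔ (e w).2.2 = 1)) ∧
    BundleIso (fun w : bd₀ => q w) p₀ ∧ BundleIso (fun w : bd₁ => q w) p₁

/-- `p₀` and `p₁` are fiberwise bordant `F`-bundles. -/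
def FiberwiseBordant.{w} (F : Type*) [TopologicalSpace F] {M E₀ E₁ : Type*} [TopologicalSpace M]
    [TopologicalSpace E₀] [TopologicalSpace E₁] (p₀ : E₀ → M) (p₁ : E₁ → M) : Prop :=
  ∃ (W : Type w) (_ : TopologicalSpace W) (q : W → M), IsFiberwiseBordism F p₀ p₁ q

/-- Two bundles over `M` become isomorphic after adding a trivial bundle `M × ℝᵏ` for some
`k ≥ 0`; the fiberwise product of `p : X → M` with the trivial bundle is `X × ℝᵏ → X → M`. -/
def StablyIsomorphic {M X X' : Type*} [TopologicalSpace X] [TopologicalSpace X']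
    (p : X → M) (p' : X' → M) : Prop :=
  ∃ k : ℕ, BundleIso (fun z : X × EuclideanSpace ℝ (Fin k) => p z.1)
    (fun z : X' × EuclideanSpace ℝ (Fin k) => p' z.1)

/-- The unit sphere `Sⁿ⁻¹` of `ℝⁿ`. -/
abbrev UnitSphere (n : ℕ) : Type := Metric.sphere (0 : EuclideanSpace ℝ (Fin n)) 1

/-- The radial projection `v ↦ v / ‖v‖` from `ℝⁿ ∖ {0}` to the unit sphere. -/
def radial {n : ℕ} (v : EuclideanSpace ℝ (Fin n)) (hv : v ≠ 0) : UnitSphere n :=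
  ⟨‖v‖⁻¹ • v, by
    have : ‖v‖ ≠ 0 := norm_ne_zero_iff.2 hv
    simp [norm_smul, this]⟩

/-- The Alexander trick: `alexander f` fixes the origin and performs `f` on the sphere of radius
`r` for every `r > 0`. -/
def alexander {n : ℕ} (f : UnitSphere n → UnitSphere n) (v : EuclideanSpace ℝ (Fin n)) :
    EuclideanSpace ℝ (Fin n) :=
  open scoped Classical in
  if hv : v = 0 then 0 else ‖v‖ • (f (radial v hv) : EuclideanSpace ℝ (Fin n))

theorem norm_alexander {n : ℕ} (f : UnitSphere n → UnitSphere n)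
    (v : EuclideanSpace ℝ (Fin n)) : ‖alexander f v‖ = ‖v‖ := by
  unfold alexander
  split_ifs with hv
  · simp [hv]
  · simp [norm_smul]

theorem alexander_id {n : ℕ} {f : UnitSphere n → UnitSphere n} (hf : ∀ x, f x = x)
    (v : EuclideanSpace ℝ (Fin n)) : alexander f v = v := by
  unfold alexander
  split_ifs with hv
  · simp [hv]
  · have : ‖v‖ ≠ 0 := norm_ne_zero_iff.2 hv
    simp [hf, radial, smul_smul, this]

theorem alexander_comp {n : ℕ} {f g h : UnitSphere n → UnitSphere n} (hf : ∀ x, g (f x) = h x)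
    (v : EuclideanSpace ℝ (Fin n)) : alexander g (alexander f v) = alexander h v := by
  by_cases hv : v = 0
  · simp [alexander, hv]
  · have h0 : ‖v‖ ≠ 0 := norm_ne_zero_iff.2 hv
    have h1 : alexander f v ≠ 0 := by
      rw [← norm_ne_zero_iff, norm_alexander]; exact h0
    have h2 : radial (alexander f v) h1 = f (radial v hv) := by
      apply Subtype.ext
      change ‖alexander f v‖⁻¹ • alexander f v = _
      rw [norm_alexander]
      simp [alexander, hv, smul_smul, h0]
    rw [alexander, dif_neg h1, h2, norm_alexander, hf]
    simp [alexander, hv]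

theorem continuousOn_alexander {n : ℕ} {M : Type*} [TopologicalSpace M] {s : Set M}
    {f : M → UnitSphere n → UnitSphere n}
    (hf : ContinuousOn (fun x : M × UnitSphere n => f x.1 x.2) (s ×ˢ univ)) :
    ContinuousOn (fun x : M × EuclideanSpace ℝ (Fin n) => alexander (f x.1) x.2)
      (s ×ˢ univ) := by
  rintro ⟨b, v⟩ hb
  by_cases hv : v = 0
  · subst hv
    have h0 : alexander (f b) (0 : EuclideanSpace ℝ (Fin n)) = 0 := by simp [alexander]
    change Tendsto _ _ (𝓝 (alexander (f b) 0))
    rw [h0]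
    apply squeeze_zero_norm (a := fun x : M × EuclideanSpace ℝ (Fin n) => ‖x.2‖)
    · intro x
      exact (norm_alexander _ _).le
    · have : ContinuousAt (fun x : M × EuclideanSpace ℝ (Fin n) => ‖x.2‖) (b, 0) := by fun_prop
      have h := this.tendsto
      simp only [norm_zero] at h
      exact h.mono_left nhdsWithin_le_nhds
  · have hopen : IsOpen {x : M × EuclideanSpace ℝ (Fin n) | x.2 ≠ 0} :=
      isOpen_ne_fun continuous_snd continuous_const
    rw [← continuousWithinAt_inter (hopen.mem_nhds (x := (b, v)) hv)]
    suffices h : ContinuousOn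
        (fun x : M × EuclideanSpace ℝ (Fin n) => alexander (f x.1) x.2)
        (s ×ˢ univ ∩ {x : M × EuclideanSpace ℝ (Fin n) | x.2 ≠ 0}) from h _ ⟨hb, hv⟩
    rw [continuousOn_iff_continuous_domRestrict]
    have key : Continuous (fun x :
        ↥(s ×ˢ univ ∩ {x : M × EuclideanSpace ℝ (Fin n) | x.2 ≠ 0}) =>
        ‖x.1.2‖ • (f x.1.1 (radial x.1.2 x.2.2) : EuclideanSpace ℝ (Fin n))) := by
      refine Continuous.smul (continuous_norm.comp
        (continuous_snd.comp continuous_subtype_val)) (continuous_subtype_val.comp ?_)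
      refine hf.comp_continuous (f := fun x :
        ↥(s ×ˢ univ ∩ {x : M × EuclideanSpace ℝ (Fin n) | x.2 ≠ 0}) =>
        (x.1.1, radial x.1.2 x.2.2)) ?_ (fun x => ⟨x.2.1.1, mem_univ _⟩)
      have hsnd : Continuous (fun x :
          ↥(s ×ˢ univ ∩ {x : M × EuclideanSpace ℝ (Fin n) | x.2 ≠ 0}) => x.1.2) :=
        continuous_snd.comp continuous_subtype_val
      refine Continuous.prodMk (continuous_fst.comp continuous_subtype_val)
        (Continuous.subtype_mk ?_ _)
      refine Continuous.smul (Continuous.inv₀ hsnd.norm ?_) hsnd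
      exact fun x => norm_ne_zero_iff.2 x.2.2
    refine key.congr fun x => ?_
    simp only [domRestrict_apply, alexander]
    rw [dif_neg x.2.2]

/-- The `ℝⁿ`-bundle induced from an `Sⁿ⁻¹`-bundle `p : E → M` by the Alexander trick: it is glued
from the sets `U × ℝⁿ`, one for each local trivialization of `p` over an open set `U`, along the
images under the Alexander trick of the coordinate changes of `p`. -/
def inducedCore {n : ℕ} {M E : Type*} [TopologicalSpace M] [TopologicalSpace E] {p : E → M}
    (hp : IsTopBundle (UnitSphere n) p) :
    FiberBundleCore (Trivialization (UnitSphere n) p) M (EuclideanSpace ℝ (Fin n)) where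
  baseSet e := e.baseSet
  isOpen_baseSet e := e.open_baseSet
  indexAt b := (hp b).choose
  mem_baseSet_at b := (hp b).choose_spec
  coordChange e e' b := alexander (e.coordChange e' b)
  coordChange_self e b hb := alexander_id (e.coordChange_same_apply hb)
  continuousOn_coordChange e e' := by
    apply continuousOn_alexander
    refine continuous_snd.comp_continuousOn
      (e'.continuousOn_toFun.comp (e.continuousOn_invFun.mono ?_) ?_)
    · rintro ⟨b, x⟩ hb
      exact e.mem_target.2 hb.1.1
    · rintro ⟨b, x⟩ hb
      have := e.proj_symm_apply' (x := x) hb.1.1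
      apply e'.mem_source.2
      exact (congrArg (· ∈ e'.baseSet) this).mpr hb.1.2
  coordChange_comp e e' e'' b hb :=
    alexander_comp (e.coordChange_coordChange e' e'' hb.1.1 hb.1.2)

/-- The projection to `M` of the `ℝⁿ`-bundle induced from `p` by the Alexander trick. -/
abbrev inducedProj {n : ℕ} {M E : Type*} [TopologicalSpace M] [TopologicalSpace E] {p : E → M}
    (hp : IsTopBundle (UnitSphere n) p) : (inducedCore hp).TotalSpace → M :=
  (inducedCore hp).proj

end

/-! An end-preserving homeomorphism `f` of `Sⁿ⁻¹ × [0,1]` acts on `ℝⁿ × ℝ` by an isotopy from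
`α(f|Sⁿ⁻¹ × {0}) × id`, at time `0`, to `α(f|Sⁿ⁻¹ × {1}) × id`, at time `1`: put a copy of `f` of
height `r` on the cylinder of radius `r`, and let it come down from `+∞` to `-∞`. The isotopy is
multiplicative in `f`, so the transition functions of the bordism give a bundle over `M` with a
time coordinate, whose level sets at the times `0` and `1` are `Ê₀ × ℝ` and `Ê₁ × ℝ`. The level
sets are isomorphic, since time can be shifted in one chart at a time: compose, in a linear order
of the indices, the shifts in the charts weighted by a partition of unity. Thus `k = 1` suffices.
-/

noncomputable section

section BundleIso

variable {M E E' E'' : Type*} [TopologicalSpace E] [TopologicalSpace E'] [TopologicalSpace E'']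
  {p : E → M} {p' : E' → M} {p'' : E'' → M}

theorem BundleIso.symm (h : BundleIso p p') : BundleIso p' p := by
  obtain ⟨φ, hφ⟩ := h
  exact ⟨φ.symm, fun x => by rw [← hφ, φ.apply_symm_apply]⟩

theorem BundleIso.trans (h : BundleIso p p') (h' : BundleIso p' p'') : BundleIso p p'' := by
  obtain ⟨φ, hφ⟩ := h
  obtain ⟨ψ, hψ⟩ := h'
  exact ⟨φ.trans ψ, fun x => (hψ _).trans (hφ _)⟩

theorem BundleIso.prodCongr {K K' : Type*} [TopologicalSpace K] [TopologicalSpace K']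
    (h : BundleIso p p') (k : K ≃ₜ K') :
    BundleIso (fun z : E × K => p z.1) (fun z : E' × K' => p' z.1) := by
  obtain ⟨φ, hφ⟩ := h
  exact ⟨φ.prodCongr k, fun z => hφ z.1⟩

theorem IsTopBundle.continuous {F : Type*} [TopologicalSpace F] [TopologicalSpace M]
    (hp : IsTopBundle F p) : Continuous p :=
  continuous_iff_continuousAt.2 fun x =>
    let ⟨e, he⟩ := hp (p x)
    e.continuousAt_proj (e.mem_source.2 he)

end BundleIso

section Cocycle

variable {ι F K M X X' : Type*} [TopologicalSpace F] [TopologicalSpace K] [TopologicalSpace M]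
  [TopologicalSpace X] [TopologicalSpace X'] {p : X → M} {p' : X' → M}
  {U : ι → Set M} {g : ι → ι → M → F → F}

/-- `g` is a cocycle of transition functions of the bundle `p` over the sets `U i`: there are local
trivializations over the `U i` whose coordinate changes are the `g i j b`. -/
def HasCocycle (p : X → M) (U : ι → Set M) (g : ι → ι → M → F → F) : Prop :=
  ∃ e : ι → Trivialization F p, (∀ i, (e i).baseSet = U i) ∧
    ∀ i j, ∀ b ∈ U i ∩ U j, ∀ v, (e i).coordChange (e j) b v = g i j b v

/-- The fiberwise map that is the identity in the local trivializations `e i` and `e' i`; over a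
point `b` it is defined through the index `k b`. -/
def chartwiseMap (e : ι → Trivialization F p) (e' : ι → Trivialization F p') (k : M → ι) (x : X) :
    X' :=
  (e' (k (p x))).toOpenPartialHomeomorph.symm (p x, (e (k (p x)) x).2)

section ChartwiseMap

variable {e : ι → Trivialization F p} {e' : ι → Trivialization F p'} {k : M → ι}

theorem chartwiseMap_eq (he : ∀ i, (e i).baseSet = U i) (he' : ∀ i, (e' i).baseSet = U i)
    (hk : ∀ b, b ∈ U (k b))
    (hee' : ∀ i j, ∀ b ∈ U i ∩ U j, ∀ v,
      (e i).coordChange (e j) b v = (e' i).coordChange (e' j) b v)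
    {i : ι} {x : X} (hx : p x ∈ U i) :
    chartwiseMap e e' k x = (e' i).toOpenPartialHomeomorph.symm (p x, (e i x).2) := by
  have hkx := hk (p x)
  set j := k (p x) with hj
  have hv : (e i x).2 = (e' j).coordChange (e' i) (p x) (e j x).2 := by
    rw [← hee' j i _ ⟨hkx, hx⟩,
      (e j).coordChange_apply_snd (e i) ((he j).symm ▸ hkx)]
  have hproj : p' ((e' j).toOpenPartialHomeomorph.symm (p x, (e j x).2)) = p x :=
    (e' j).proj_symm_apply' ((he' j).symm ▸ hkx)
  rw [chartwiseMap, ← hj, hv, (e' j).mk_coordChange (e' i) ((he' j).symm ▸ hkx)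
    ((he' i).symm ▸ hx)]
  exact ((e' i).toOpenPartialHomeomorph.left_inv
    ((e' i).mem_source.2 (by rw [hproj, he']; exact hx))).symm

theorem proj_chartwiseMap (hk : ∀ b, b ∈ (e' (k b)).baseSet) (x : X) :
    p' (chartwiseMap e e' k x) = p x :=
  (e' _).proj_symm_apply' (hk _)

theorem chartwiseMap_chartwiseMap (hk : ∀ b, b ∈ (e (k b)).baseSet)
    (hk' : ∀ b, b ∈ (e' (k b)).baseSet) (x : X) :
    chartwiseMap e' e k (chartwiseMap e e' k x) = x := by
  rw [chartwiseMap, proj_chartwiseMap hk', chartwiseMap, (e' _).apply_symm_apply' (hk' _),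
    (e _).symm_apply_mk_proj ((e _).mem_source.2 (hk _))]

theorem continuous_chartwiseMap (he : ∀ i, (e i).baseSet = U i) (he' : ∀ i, (e' i).baseSet = U i)
    (hk : ∀ b, b ∈ U (k b))
    (hee' : ∀ i j, ∀ b ∈ U i ∩ U j, ∀ v,
      (e i).coordChange (e j) b v = (e' i).coordChange (e' j) b v) :
    Continuous (chartwiseMap e e' k) := by
  refine continuous_iff_continuousAt.2 fun x => ?_
  set i := k (p x)
  have hx : p x ∈ U i := hk (p x)
  have hxi : p x ∈ (e i).baseSet := (he i).symm ▸ hx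
  have hcont : ContinuousAt p x := (e i).continuousAt_proj ((e i).mem_source.2 hxi)
  have hsymm : ContinuousAt (e' i).toOpenPartialHomeomorph.symm (p x, (e i x).2) :=
    (e' i).toOpenPartialHomeomorph.continuousAt_symm
      ((e' i).mem_target.2 (by rw [he']; exact hx))
  refine ContinuousAt.congr (f := fun y => (e' i).toOpenPartialHomeomorph.symm (p y, (e i y).2))
    (ContinuousAt.comp (f := fun y => (p y, (e i y).2)) hsymm
      (hcont.prodMk ((e i).continuousAt ((e i).mem_source.2 hxi)).snd)) ?_
  filter_upwards [hcont ((e i).open_baseSet.mem_nhds hxi)] with y hy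
  exact (chartwiseMap_eq he he' hk hee' (he i ▸ hy)).symm

end ChartwiseMap

theorem HasCocycle.bundleIso (h : HasCocycle p U g) (h' : HasCocycle p' U g)
    (hU : ∀ b, ∃ i, b ∈ U i) : BundleIso p p' := by
  obtain ⟨e, he, hg⟩ := h
  obtain ⟨e', he', hg'⟩ := h'
  choose k hk using hU
  have hk₁ : ∀ b, b ∈ (e (k b)).baseSet := fun b => (he _).symm ▸ hk b
  have hk₂ : ∀ b, b ∈ (e' (k b)).baseSet := fun b => (he' _).symm ▸ hk b
  have hee' : ∀ i j, ∀ b ∈ U i ∩ U j, ∀ v,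
      (e i).coordChange (e j) b v = (e' i).coordChange (e' j) b v := fun i j b hb v =>
    (hg i j b hb v).trans (hg' i j b hb v).symm
  exact ⟨{
    toFun := chartwiseMap e e' k
    invFun := chartwiseMap e' e k
    left_inv := chartwiseMap_chartwiseMap hk₁ hk₂
    right_inv := chartwiseMap_chartwiseMap hk₂ hk₁
    continuous_toFun := continuous_chartwiseMap he he' hk hee'
    continuous_invFun := continuous_chartwiseMap he' he hk
      fun i j b hb v => (hee' i j b hb v).symm }, proj_chartwiseMap hk₂⟩

theorem HasCocycle.of_bundleIso (h : HasCocycle p U g) (hpp' : BundleIso p p') :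
    HasCocycle p' U g := by
  obtain ⟨e, he, hg⟩ := h
  obtain ⟨φ, hφ⟩ := hpp'
  obtain rfl : p ∘ φ.symm = p' := funext fun x => by
    rw [Function.comp_apply, ← hφ, φ.apply_symm_apply]
  refine ⟨fun i => (e i).compHomeomorph φ.symm, he, fun i j b hb v => ?_⟩
  rw [← hg i j b hb v]
  change (e j (φ.symm (φ ((e i).toOpenPartialHomeomorph.symm (b, v))))).2 = _
  rw [φ.symm_apply_apply]
  rfl

theorem HasCocycle.congr {g' : ι → ι → M → F → F} (h : HasCocycle p U g)
    (hg : ∀ i j, ∀ b ∈ U i ∩ U j, ∀ v, g i j b v = g' i j b v) : HasCocycle p U g' := by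
  obtain ⟨e, he, heg⟩ := h
  exact ⟨e, he, fun i j b hb v => (heg i j b hb v).trans (hg i j b hb v)⟩

/-- The trivialization of the product of a bundle with the trivial bundle with fiber `K`. -/
def prodTrivialization (e : Trivialization F p) (K : Type*) [TopologicalSpace K] :
    Trivialization (F × K) (fun z : X × K => p z.1) where
  toOpenPartialHomeomorph := (e.toOpenPartialHomeomorph.prod
    (OpenPartialHomeomorph.refl K)).transHomeomorph (Homeomorph.prodAssoc M F K)
  baseSet := e.baseSet
  open_baseSet := e.open_baseSet
  source_eq := by
    ext z
    simp [e.mem_source]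
  target_eq := by
    ext z
    exact (and_congr_left' e.mem_target).trans Iff.rfl
  proj_toFun z hz := e.coe_fst hz.1

theorem HasCocycle.prod (h : HasCocycle p U g) (K : Type*) [TopologicalSpace K] :
    HasCocycle (fun z : X × K => p z.1) U fun i j b (v : F × K) => (g i j b v.1, v.2) := by
  obtain ⟨e, he, hg⟩ := h
  refine ⟨fun i => prodTrivialization (e i) K, he, fun i j b hb v => ?_⟩
  exact Prod.ext (hg i j b hb v.1) rfl

theorem localTriv_coordChange (Z : FiberBundleCore ι M F) {i j : ι} {b : M}
    (hb : b ∈ Z.baseSet i ∩ Z.baseSet j) (v : F) :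
    (Z.localTriv i).coordChange (Z.localTriv j) b v = Z.coordChange i j b v := by
  rw [Trivialization.coordChange, Z.localTriv_symm_apply, Z.localTriv_apply]
  exact Z.coordChange_comp _ _ _ _ ⟨⟨hb.1, Z.mem_baseSet_at b⟩, hb.2⟩ v

theorem HasCocycle.inducedProj {n : ℕ} (hp : IsTopBundle (UnitSphere n) p)
    {g : ι → ι → M → UnitSphere n → UnitSphere n} (h : HasCocycle p U g) :
    HasCocycle (inducedProj hp) U fun i j b => alexander (g i j b) := by
  obtain ⟨e, he, hg⟩ := h
  refine ⟨fun i => (inducedCore hp).localTriv (e i), he, fun i j b hb v => ?_⟩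
  have hb' : b ∈ (e i).baseSet ∩ (e j).baseSet := by rwa [he, he]
  exact (localTriv_coordChange (inducedCore hp) hb' v).trans
    (congrArg (alexander · v) (funext (hg i j b hb)))

end Cocycle

section FiberMap

variable {F M X : Type*} [TopologicalSpace F] [TopologicalSpace M] [TopologicalSpace X]
  {p : X → M} {e : Trivialization F p} {g g' : M → F → F}

open scoped Classical in
/-- The fiberwise map that is `g b` in the chart `e` on the fiber over a point `b` of the base set
of `e`, and the identity on the other fibers. -/
def fiberMap (e : Trivialization F p) (g : M → F → F) (x : X) : X :=
  if p x ∈ e.baseSet then e.toOpenPartialHomeomorph.symm (p x, g (p x) (e x).2) else x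

theorem proj_fiberMap (x : X) : p (fiberMap e g x) = p x := by
  unfold fiberMap
  split_ifs with hx
  · exact e.proj_symm_apply' hx
  · rfl

theorem apply_fiberMap {x : X} (hx : p x ∈ e.baseSet) :
    e (fiberMap e g x) = (p x, g (p x) (e x).2) := by
  rw [fiberMap, if_pos hx, e.apply_symm_apply' hx]

theorem fiberMap_of_eq_id {x : X} (hg : ∀ v, g (p x) v = v) : fiberMap e g x = x := by
  unfold fiberMap
  split_ifs with hx
  · rw [hg, e.symm_apply_mk_proj (e.mem_source.2 hx)]
  · rfl

theorem fiberMap_fiberMap (hg : ∀ b v, g' b (g b v) = v) (x : X) :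
    fiberMap e g' (fiberMap e g x) = x := by
  by_cases hx : p x ∈ e.baseSet
  · rw [fiberMap, proj_fiberMap (p := p), if_pos hx, apply_fiberMap hx, hg,
      e.symm_apply_mk_proj (e.mem_source.2 hx)]
  · simp only [fiberMap, hx, if_false]

theorem continuous_fiberMap (hp : Continuous p) (hg : Continuous fun x : M × F => g x.1 x.2)
    {s : Set M} (hs : IsClosed s) (hse : s ⊆ e.baseSet) (hid : ∀ b ∉ s, ∀ v, g b v = v) :
    Continuous (fiberMap e g) := by
  refine continuous_iff_continuousAt.2 fun x => ?_
  by_cases hx : p x ∈ e.baseSet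
  · have he : ContinuousAt (fun y => (e y).2) x := (e.continuousAt (e.mem_source.2 hx)).snd
    have hpe : ContinuousAt (fun y => (p y, g (p y) (e y).2)) x :=
      hp.continuousAt.prodMk (hg.continuousAt.comp (hp.continuousAt.prodMk he))
    refine ContinuousAt.congr (f := fun y => e.toOpenPartialHomeomorph.symm
      (p y, g (p y) (e y).2)) (ContinuousAt.comp (f := fun y => (p y, g (p y) (e y).2))
        (e.toOpenPartialHomeomorph.continuousAt_symm (e.mem_target.2 hx)) hpe) ?_
    filter_upwards [hp.continuousAt (e.open_baseSet.mem_nhds hx)] with y hy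
    exact (if_pos hy).symm
  · refine continuousAt_id.congr ?_
    filter_upwards [hp.continuousAt (hs.isOpen_compl.mem_nhds fun h => hx (hse h))] with y hy
    exact (fiberMap_of_eq_id (hid _ hy)).symm

theorem exists_homeomorph_chartShift (hp : Continuous p) {t : X → ℝ}
    {e : Trivialization (F × ℝ) p} (he : ∀ x ∈ e.source, (e x).2.2 = t x) {l : M → ℝ}
    (hl : Continuous l) (hle : tsupport l ⊆ e.baseSet) :
    ∃ T : X ≃ₜ X, ∀ x,
      p (T x) = p x ∧ t (T x) = t x + l (p x) ∧ (l (p x) = 0 → T x = x) := by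
  have hl₀ : ∀ b ∉ tsupport l, l b = 0 := fun b => image_eq_zero_of_notMem_tsupport
  let shift (b : M) (v : F × ℝ) : F × ℝ := (v.1, v.2 + l b)
  let unshift (b : M) (v : F × ℝ) : F × ℝ := (v.1, v.2 - l b)
  have hid : ∀ {x}, l (p x) = 0 → fiberMap e shift x = x := fun hx =>
    fiberMap_of_eq_id fun v => by simp only [shift, hx, add_zero, Prod.mk.eta]
  refine ⟨{
    toFun := fiberMap e shift
    invFun := fiberMap e unshift
    left_inv := fiberMap_fiberMap fun b v => by simp [shift, unshift]
    right_inv := fiberMap_fiberMap fun b v => by simp [shift, unshift]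
    continuous_toFun := continuous_fiberMap hp (by fun_prop) (isClosed_tsupport l) hle
      fun b hb v => by simp [shift, hl₀ b hb]
    continuous_invFun := continuous_fiberMap hp (by fun_prop) (isClosed_tsupport l) hle
      fun b hb v => by simp [unshift, hl₀ b hb] }, fun x => ?_⟩
  change p (fiberMap e shift x) = p x ∧ t (fiberMap e shift x) = t x + l (p x) ∧ _
  refine ⟨proj_fiberMap x, ?_, hid⟩
  by_cases hx : p x ∈ e.baseSet
  · have hsx : fiberMap e shift x ∈ e.source := e.mem_source.2 (by rwa [proj_fiberMap (p := p)])
    rw [← he _ hsx, apply_fiberMap hx, ← he x (e.mem_source.2 hx)]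
  · have hlx : l (p x) = 0 := hl₀ _ fun h => hx (hle h)
    rw [hid hlx, hlx, add_zero]

end FiberMap

section OrderedComposition

variable {ι X M : Type*} [TopologicalSpace X] {q : X → M} {T : ι → X ≃ₜ X} {s : ι → Set M}

theorem proj_prod_map (hq : ∀ i x, q (T i x) = q x) (L : List ι) (x : X) :
    q ((L.map T).prod x) = q x := by
  induction L with
  | nil => rfl
  | cons i L ih => rw [List.map_cons, List.prod_cons, Homeomorph.mul_apply, hq, ih]

theorem prod_map_filter (hq : ∀ i x, q (T i x) = q x) (hid : ∀ i x, q x ∉ s i → T i x = x)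
    (x : X) [DecidablePred fun i => q x ∈ s i] (L : List ι) :
    ((L.filter fun i => q x ∈ s i).map T).prod x = (L.map T).prod x := by
  induction L with
  | nil => rfl
  | cons i L ih =>
    rw [List.map_cons, List.prod_cons, Homeomorph.mul_apply, ← ih]
    by_cases hi : q x ∈ s i
    · simp [hi]
    · rw [hid i _ (by rwa [proj_prod_map hq])]
      simp [hi]

variable [LinearOrder ι]

/-- The composition of the homeomorphisms `T i` with `i ∈ K`, in the order of the indices. -/
def compositeOn (T : ι → X ≃ₜ X) (K : Finset ι) : X ≃ₜ X :=
  ((K.sort (· ≤ ·)).map T).prod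

theorem proj_compositeOn (hq : ∀ i x, q (T i x) = q x) (K : Finset ι) (x : X) :
    q (compositeOn T K x) = q x :=
  proj_prod_map hq _ x

theorem compositeOn_congr (hq : ∀ i x, q (T i x) = q x) (hid : ∀ i x, q x ∉ s i → T i x = x)
    {K K' : Finset ι} {x : X} (hK : ∀ i, q x ∈ s i → (i ∈ K ↔ i ∈ K')) :
    compositeOn T K x = compositeOn T K' x := by
  classical
  unfold compositeOn
  rw [← prod_map_filter hq hid, ← prod_map_filter hq hid x (K'.sort _)]
  congr 3
  refine List.Perm.eq_of_pairwise (le := (· ≤ ·)) (fun _ _ _ _ => le_antisymm)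
    ((Finset.pairwise_sort _ _).filter _) ((Finset.pairwise_sort _ _).filter _)
    ((List.perm_ext_iff_of_nodup ((Finset.sort_nodup _ _).filter _)
      ((Finset.sort_nodup _ _).filter _)).2 fun i => ?_)
  simpa only [List.mem_filter, Finset.mem_sort, decide_eq_true_eq] using and_congr_left (hK i)

theorem compositeOn_translates (hq : ∀ i x, q (T i x) = q x) {t : X → ℝ} {l : ι → M → ℝ}
    (ht : ∀ i x, t (T i x) = t x + l i (q x)) (K : Finset ι) (x : X) :
    t (compositeOn T K x) = t x + ∑ i ∈ K, l i (q x) := by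
  have hlist : ∀ L : List ι, t ((L.map T).prod x) = t x + (L.map fun i => l i (q x)).sum := by
    intro L
    induction L with
    | nil => simp
    | cons i L ih =>
      rw [List.map_cons, List.prod_cons, Homeomorph.mul_apply, ht, ih, proj_prod_map hq,
        List.map_cons, List.sum_cons, add_assoc, add_comm (List.sum _)]
  rw [compositeOn, hlist, ← List.sum_toFinset _ (Finset.sort_nodup _ _), Finset.sort_toFinset]

theorem exists_homeomorph_eq_compositeOn [TopologicalSpace M] (hqc : Continuous q)
    (hq : ∀ i x, q (T i x) = q x) (hs : LocallyFinite s)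
    (hid : ∀ i x, q x ∉ s i → T i x = x) :
    ∃ H : X ≃ₜ X, ∀ x (K : Finset ι), (∀ i, q x ∈ s i → i ∈ K) → H x = compositeOn T K x := by
  let active (b : M) : Finset ι := (hs.point_finite b).toFinset
  have mem_active {b : M} {i : ι} : i ∈ active b ↔ b ∈ s i := by simp [active]
  let H (x : X) : X := compositeOn T (active (q x)) x
  have hH : ∀ x (K : Finset ι), (∀ i, q x ∈ s i → i ∈ K) → H x = compositeOn T K x :=
    fun x K hK => compositeOn_congr hq hid fun i hi => iff_of_true (mem_active.2 hi) (hK i hi)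
  have hlocal : IsLocalHomeomorph H := by
    refine IsLocalHomeomorph.mk H fun x => ?_
    obtain ⟨U, hU, hfin⟩ := hs (q x)
    obtain ⟨V, hVU, hVo, hxV⟩ := mem_nhds_iff.1 hU
    refine ⟨(compositeOn T hfin.toFinset).toOpenPartialHomeomorph.restrOpen (q ⁻¹' V)
      (hVo.preimage hqc), ⟨mem_univ _, hxV⟩, fun y hy => hH y _ fun i hi => ?_⟩
    exact hfin.mem_toFinset.2 ⟨q y, hi, hVU hy.2⟩
  have hbij : Function.Bijective H := by
    refine ⟨fun x y hxy => ?_, fun y => ?_⟩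
    · have hqxy : q x = q y := by
        rw [← proj_compositeOn hq (active (q x)) x, ← proj_compositeOn hq (active (q y)) y]
        exact congrArg q hxy
      refine (compositeOn T (active (q y))).injective ?_
      rw [← hH x _ fun i hi => mem_active.2 (hqxy ▸ hi)]
      exact hxy
    · obtain ⟨x, hx⟩ := (compositeOn T (active (q y))).surjective y
      have hqx : q x = q y := by rw [← hx, proj_compositeOn hq]
      exact ⟨x, (hH x _ fun i hi => mem_active.2 (hqx ▸ hi)).trans hx⟩
  exact ⟨hlocal.toHomeomorphOfBijective hbij, hH⟩

end OrderedComposition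

section LevelSets

variable {F M X : Type*} [TopologicalSpace F] [TopologicalSpace M] [NormalSpace M]
  [ParacompactSpace M] [TopologicalSpace X] {p : X → M} {t : X → ℝ}

theorem exists_homeomorph_translates
    (h : ∀ b, ∃ e : Trivialization (F × ℝ) p, b ∈ e.baseSet ∧ ∀ x ∈ e.source, (e x).2.2 = t x)
    (c : ℝ) : ∃ H : X ≃ₜ X, ∀ x, p (H x) = p x ∧ t (H x) = t x + c := by
  have hp : Continuous p := IsTopBundle.continuous fun b => (h b).imp fun _ => And.left
  choose e hb het using h
  obtain ⟨ρ, hρ⟩ := PartitionOfUnity.exists_isSubordinate isClosed_univ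
    (fun b => (e b).baseSet) (fun b => (e b).open_baseSet)
    (fun b _ => mem_iUnion.2 ⟨b, hb b⟩)
  have hshift (i : M) := exists_homeomorph_chartShift hp (het i)
    (l := fun b => ρ i b * c) (by fun_prop) (tsupport_mul_subset_left.trans (hρ i))
  choose T hTp hTt hTid using hshift
  classical
  let _ : LinearOrder M := linearOrderOfSTO WellOrderingRel
  obtain ⟨H, hH⟩ := exists_homeomorph_eq_compositeOn hp hTp ρ.locallyFinite
    fun i x hx => hTid i x (by rw [Function.notMem_support.1 hx, zero_mul])
  have hHx (x : X) : H x = compositeOn T (ρ.finsupport (p x)) x :=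
    hH x _ fun i hi => (ρ.mem_finsupport _).2 hi
  refine ⟨H, fun x => ⟨by rw [hHx, proj_compositeOn hTp], ?_⟩⟩
  rw [hHx, compositeOn_translates (l := fun i b => ρ i b * c) hTp hTt, ← Finset.sum_mul,
    ρ.sum_finsupport (mem_univ _), one_mul]

theorem bundleIso_levelSet
    (h : ∀ b, ∃ e : Trivialization (F × ℝ) p, b ∈ e.baseSet ∧ ∀ x ∈ e.source, (e x).2.2 = t x)
    (a a' : ℝ) :
    BundleIso (fun x : {x | t x = a} => p x) (fun x : {x | t x = a'} => p x) := by
  obtain ⟨H, hH⟩ := exists_homeomorph_translates h (a' - a)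
  refine ⟨H.subtype fun x => ?_, fun x => (hH x).1⟩
  rw [mem_ofPred_eq, mem_ofPred_eq, (hH x).2]
  exact ⟨fun h => by linarith, fun h => by linarith⟩

end LevelSets

section Slices

variable {S T M W : Type*} [TopologicalSpace S] [TopologicalSpace T] [TopologicalSpace M]
  [TopologicalSpace W] {q : W → M} {A : Set W} {c : T} {e e' : Trivialization (S × T) q}

/-- In the chart `e` of an `S × T`-bundle, the subspace `A` is the slice `S × {c}` of the
fibers. -/
def IsSlice (e : Trivialization (S × T) q) (A : Set W) (c : T) : Prop :=
  ∀ w ∈ e.source, w ∈ A ↔ (e w).2.2 = c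

theorem IsSlice.symm_mem (h : IsSlice e A c) {b : M} (hb : b ∈ e.baseSet) (θ : S) :
    e.toOpenPartialHomeomorph.symm (b, θ, c) ∈ A := by
  rw [h _ (e.map_target (e.mem_target.2 hb)), e.apply_symm_apply' hb]

theorem IsSlice.coordChange_snd (h : IsSlice e A c) (h' : IsSlice e' A c) {b : M}
    (hb : b ∈ e.baseSet ∩ e'.baseSet) (θ : S) : (e.coordChange e' b (θ, c)).2 = c :=
  (h' _ (e'.mem_source.2 (by rw [e.proj_symm_apply' hb.1]; exact hb.2))).1 (h.symm_mem hb.1 θ)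

open scoped Classical in
/-- The trivialization of the bundle of slices `A` given by a chart of the ambient bundle. The
values of `z` are the junk values of the inverse map off the base set. -/
def sliceTrivialization (h : IsSlice e A c) (z : M × S → A) :
    Trivialization S (fun w : A => q w) where
  toFun w := (q w, (e w).2.1)
  invFun y := if hy : y.1 ∈ e.baseSet then ⟨_, h.symm_mem hy y.2⟩ else z y
  source := (fun w : A => (w : W)) ⁻¹' (q ⁻¹' e.baseSet)
  target := e.baseSet ×ˢ univ
  map_source' w hw := ⟨hw, mem_univ _⟩
  map_target' y hy := by
    rw [dif_pos hy.1, mem_preimage, mem_preimage, e.proj_symm_apply' hy.1]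
    exact hy.1
  left_inv' w hw := by
    have hsrc : (w : W) ∈ e.source := e.mem_source.2 hw
    rw [dif_pos (show (q w, (e w).2.1).1 ∈ e.baseSet from hw), Subtype.ext_iff]
    refine (congrArg (fun a => e.toOpenPartialHomeomorph.symm (q w, (e w).2.1, a))
      ((h w hsrc).1 w.2).symm).trans (e.symm_apply_mk_proj hsrc)
  right_inv' y hy := by
    simp only [dif_pos hy.1, e.proj_symm_apply' hy.1, e.apply_symm_apply' hy.1]
  open_source := by
    rw [← e.source_eq]
    exact e.open_source.preimage continuous_subtype_val
  open_target := e.open_baseSet.prod isOpen_univ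
  continuousOn_toFun := by
    have he : ContinuousOn (fun w : A => e w) ((fun w : A => (w : W)) ⁻¹' (q ⁻¹' e.baseSet)) :=
      e.continuousOn_toFun.comp (f := fun w : A => (w : W)) continuous_subtype_val.continuousOn
        fun w hw => e.mem_source.2 hw
    exact (he.fst.congr fun w hw => (e.coe_fst (e.mem_source.2 hw)).symm).prodMk he.snd.fst
  continuousOn_invFun := by
    rw [continuousOn_iff_continuous_domRestrict]
    have he : Continuous fun y : ↥(e.baseSet ×ˢ (univ : Set S)) =>
        e.toOpenPartialHomeomorph.symm (y.1.1, y.1.2, c) :=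
      e.toOpenPartialHomeomorph.symm.continuousOn.comp_continuous (by fun_prop)
        fun y => e.mem_target.2 y.2.1
    refine (he.subtype_mk fun y => h.symm_mem y.2.1 y.1.2).congr fun y => ?_
    rw [domRestrict_apply, dif_pos y.2.1]
  baseSet := e.baseSet
  open_baseSet := e.open_baseSet
  source_eq := rfl
  target_eq := rfl
  proj_toFun _ _ := rfl

theorem coe_sliceTrivialization_symm (h : IsSlice e A c) (z : M × S → A) {b : M}
    (hb : b ∈ e.baseSet) (θ : S) :
    ((sliceTrivialization h z).toOpenPartialHomeomorph.symm (b, θ) : W) =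
      e.toOpenPartialHomeomorph.symm (b, θ, c) :=
  congrArg Subtype.val (dif_pos hb)

theorem sliceTrivialization_coordChange (h : IsSlice e A c) (h' : IsSlice e' A c)
    (z : M × S → A) {b : M} (hb : b ∈ e.baseSet) (θ : S) :
    (sliceTrivialization h z).coordChange (sliceTrivialization h' z) b θ =
      (e.coordChange e' b (θ, c)).1 := by
  change (e' ((sliceTrivialization h z).toOpenPartialHomeomorph.symm (b, θ))).2.1 = _
  rw [coe_sliceTrivialization_symm h z hb]
  rfl

theorem hasCocycle_slice {e : M → Trivialization (S × T) q} (he : ∀ b, b ∈ (e b).baseSet)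
    (h : ∀ b, IsSlice (e b) A c) :
    HasCocycle (fun w : A => q w) (fun i => (e i).baseSet)
      fun i j b θ => ((e i).coordChange (e j) b (θ, c)).1 :=
  ⟨fun i => sliceTrivialization (h i) fun y => ⟨_, (h y.1).symm_mem (he y.1) y.2⟩,
    fun _ => rfl, fun i j _ hb θ => sliceTrivialization_coordChange (h i) (h j) _ hb.1 θ⟩

theorem continuousOn_trivialization_coordChange (e e' : Trivialization S q) :
    ContinuousOn (fun x : M × S => e.coordChange e' x.1 x.2)
      ((e.baseSet ∩ e'.baseSet) ×ˢ univ) := by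
  refine continuous_snd.comp_continuousOn (e'.continuousOn_toFun.comp
    (e.toOpenPartialHomeomorph.continuousOn_symm.mono fun x hx => e.mem_target.2 hx.1.1)
    fun x hx => ?_)
  exact e'.mem_source.2 ((e.proj_symm_apply' hx.1.1).symm ▸ hx.1.2)

end Slices

section ClampRatio

variable {x y : ℝ}

/-- The quotient `x / y`, for `0 ≤ y`, clamped to `[0,1]`. The denominator is chosen such that the
clamped quotient is continuous where `x ≠ 0`, even at `y = 0`. -/
def clampRatio (x y : ℝ) : unitInterval :=
  projIcc 0 1 zero_le_one (x / max |x| y)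

theorem clampRatio_of_nonpos (hx : x ≤ 0) : clampRatio x y = 0 :=
  projIcc_of_le_left _ (div_nonpos_of_nonpos_of_nonneg hx (le_max_of_le_left (abs_nonneg x)))

theorem clampRatio_of_le (hx : 0 < x) (hyx : y ≤ x) : clampRatio x y = 1 := by
  refine projIcc_of_right_le _ (le_of_eq ?_)
  rw [abs_of_pos hx, max_eq_left hyx, div_self hx.ne']

theorem coe_clampRatio (hx : 0 ≤ x) (hxy : x ≤ y) : (clampRatio x y : ℝ) = x / y := by
  rw [clampRatio, abs_of_nonneg hx, max_eq_right hxy,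
    projIcc_of_mem _ ⟨div_nonneg hx (hx.trans hxy), div_le_one_of_le₀ hxy (hx.trans hxy)⟩]

theorem clampRatio_displace (hy : 0 ≤ y) {u : unitInterval} (h₀ : clampRatio x y = 0 → u = 0)
    (h₁ : clampRatio x y = 1 → u = 1) :
    clampRatio (x + y * (u - clampRatio x y)) y = u := by
  rcases le_or_gt x 0 with hx | hx
  · rw [clampRatio_of_nonpos hx, h₀ (clampRatio_of_nonpos hx), sub_self, mul_zero, add_zero,
      clampRatio_of_nonpos hx]
  rcases le_total y x with hyx | hxy
  · rw [clampRatio_of_le hx hyx, h₁ (clampRatio_of_le hx hyx), sub_self, mul_zero, add_zero,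
      clampRatio_of_le hx hyx]
  · have hy' : 0 < y := hx.trans_le hxy
    have hxu : x + y * (u - clampRatio x y) = y * u := by
      rw [coe_clampRatio hx.le hxy]
      field_simp
      ring
    rw [hxu, Subtype.ext_iff,
      coe_clampRatio (mul_nonneg hy u.2.1) (mul_le_of_le_one_right hy u.2.2),
      mul_div_cancel_left₀ _ hy'.ne']

theorem continuousAt_clampRatio (h : x ≠ 0 ∨ 0 < y) :
    ContinuousAt (fun z : ℝ × ℝ => clampRatio z.1 z.2) (x, y) := by
  have hpos : max |x| y ≠ 0 := (lt_max_iff.2 (h.imp_left abs_pos.2)).ne'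
  exact continuous_projIcc.continuousAt.comp (ContinuousAt.div (by fun_prop) (by fun_prop) hpos)

end ClampRatio

section CylinderHeight

/-- The height in `[0,1]` at time `t` of the point at height `s` on the cylinder of radius `r` in
`ℝⁿ × ℝ`: up to clamping it is `s / r + (2 * t - 1) / (t * (1 - t))` for `0 < t < 1`, which tends
to `-∞` and to `+∞` at the ends, hence constantly `0` for `t ≤ 0` and constantly `1` for
`1 ≤ t`. -/
def cylinderHeight (t r s : ℝ) : unitInterval :=
  clampRatio (s * max (t * (1 - t)) 0 + (2 * t - 1) * r) (r * max (t * (1 - t)) 0)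

variable {t r s : ℝ}

theorem cylinderHeight_endpoint {c : unitInterval} (hc : c = 0 ∨ c = 1) (hr : 0 < r) (s : ℝ) :
    cylinderHeight c r s = c := by
  rcases hc with rfl | rfl
  · exact clampRatio_of_nonpos (by simp [hr.le])
  · exact clampRatio_of_le (by norm_num [hr]) (by norm_num [hr.le])

theorem cylinderHeight_displace (hr : 0 ≤ r) {u : unitInterval}
    (h₀ : cylinderHeight t r s = 0 → u = 0) (h₁ : cylinderHeight t r s = 1 → u = 1) :
    cylinderHeight t r (s + r * (u - cylinderHeight t r s)) = u := by
  refine Eq.trans ?_ (clampRatio_displace (mul_nonneg hr (le_max_right (t * (1 - t)) 0)) h₀ h₁)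
  simp only [cylinderHeight]
  congr 1
  ring

theorem continuousAt_cylinderHeight (hr : 0 < r) :
    ContinuousAt (fun x : ℝ × ℝ × ℝ => cylinderHeight x.1 x.2.1 x.2.2) (t, r, s) := by
  refine (continuousAt_clampRatio ?_).comp (x := (t, r, s))
    (f := fun x : ℝ × ℝ × ℝ => (x.2.2 * max (x.1 * (1 - x.1)) 0 + (2 * x.1 - 1) * x.2.1,
      x.2.1 * max (x.1 * (1 - x.1)) 0)) (by fun_prop)
  rcases lt_or_ge 0 (t * (1 - t)) with ht | ht
  · exact Or.inr (mul_pos hr (lt_max_of_lt_left ht))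
  · left
    have ht' : 2 * t - 1 ≠ 0 := by
      intro h
      nlinarith
    simpa [max_eq_right ht, hr.ne'] using ht'

end CylinderHeight

section StableIsotopy

variable {n : ℕ}

theorem radial_smul {r : ℝ} (hr : 0 < r) (θ : UnitSphere n)
    (h : r • (θ : EuclideanSpace ℝ (Fin n)) ≠ 0) : radial (r • θ.1) h = θ := by
  apply Subtype.ext
  simp [radial, norm_smul, abs_of_pos hr, smul_smul, hr.ne']

theorem exists_eq_smul_sphere {v : EuclideanSpace ℝ (Fin n)} (hv : v ≠ 0) :
    ∃ r : ℝ, 0 < r ∧ ∃ θ : UnitSphere n, v = r • (θ : EuclideanSpace ℝ (Fin n)) :=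
  ⟨‖v‖, norm_pos_iff.2 hv, radial v hv, by simp [radial, smul_smul, hv]⟩

theorem smul_sphere_ne_zero {r : ℝ} (hr : 0 < r) (θ : UnitSphere n) :
    r • (θ : EuclideanSpace ℝ (Fin n)) ≠ 0 :=
  smul_ne_zero hr.ne' (ne_zero_of_mem_unit_sphere θ)

theorem alexander_smul (f : UnitSphere n → UnitSphere n) {r : ℝ} (hr : 0 < r)
    (θ : UnitSphere n) :
    alexander f (r • (θ : EuclideanSpace ℝ (Fin n))) = r • (f θ : EuclideanSpace ℝ (Fin n)) := by
  rw [alexander, dif_neg (smul_sphere_ne_zero hr θ), radial_smul hr]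
  simp [norm_smul, abs_of_pos hr]

/-- A self-map of the cylinder `Sⁿ⁻¹ × [0,1]` that maps each end to itself. -/
def PreservesEnds (f : UnitSphere n × unitInterval → UnitSphere n × unitInterval) : Prop :=
  ∀ c : unitInterval, c = 0 ∨ c = 1 → ∀ θ, (f (θ, c)).2 = c

open scoped Classical in
/-- The self-map of `ℝⁿ × ℝ` at time `t` of the isotopy between `α(f|Sⁿ⁻¹ × {0}) × id`, at `t = 0`,
and `α(f|Sⁿ⁻¹ × {1}) × id`, at `t = 1`, given by an end-preserving `f`. On the cylinder of radius
`r` it is a copy of `f` of height `r`, extended below and above by `f` on the ends; as `t` grows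
from `0` to `1`, this copy comes down from `+∞` and disappears at `-∞`. -/
def stableIsotopy (f : UnitSphere n × unitInterval → UnitSphere n × unitInterval) (t : ℝ)
    (x : EuclideanSpace ℝ (Fin n) × ℝ) : EuclideanSpace ℝ (Fin n) × ℝ :=
  if hv : x.1 = 0 then x
  else
    let u := cylinderHeight t ‖x.1‖ x.2
    let y := f (radial x.1 hv, u)
    (‖x.1‖ • (y.1 : EuclideanSpace ℝ (Fin n)), x.2 + ‖x.1‖ * (y.2 - u))

variable {f g h : UnitSphere n × unitInterval → UnitSphere n × unitInterval} {t : ℝ}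

theorem stableIsotopy_zero (f : UnitSphere n × unitInterval → UnitSphere n × unitInterval)
    (t s : ℝ) : stableIsotopy f t (0, s) = (0, s) :=
  dif_pos rfl

theorem stableIsotopy_smul (f : UnitSphere n × unitInterval → UnitSphere n × unitInterval)
    (t s : ℝ) {r : ℝ} (hr : 0 < r) (θ : UnitSphere n) :
    stableIsotopy f t (r • (θ : EuclideanSpace ℝ (Fin n)), s) =
      (r • ((f (θ, cylinderHeight t r s)).1 : EuclideanSpace ℝ (Fin n)),
        s + r * ((f (θ, cylinderHeight t r s)).2 - cylinderHeight t r s)) := by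
  have hnorm : ‖r • (θ : EuclideanSpace ℝ (Fin n))‖ = r := by simp [norm_smul, abs_of_pos hr]
  simp only [stableIsotopy, dif_neg (smul_sphere_ne_zero hr θ), radial_smul hr, hnorm]

theorem stableIsotopy_id (hf : ∀ y, f y = y) (x : EuclideanSpace ℝ (Fin n) × ℝ) :
    stableIsotopy f t x = x := by
  obtain ⟨v, s⟩ := x
  rcases eq_or_ne v 0 with rfl | hv
  · exact stableIsotopy_zero f t s
  · obtain ⟨r, hr, θ, rfl⟩ := exists_eq_smul_sphere hv
    rw [stableIsotopy_smul f t s hr, hf, sub_self, mul_zero, add_zero]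

theorem stableIsotopy_comp (hf : PreservesEnds f) (hgf : ∀ y, g (f y) = h y)
    (x : EuclideanSpace ℝ (Fin n) × ℝ) :
    stableIsotopy g t (stableIsotopy f t x) = stableIsotopy h t x := by
  obtain ⟨v, s⟩ := x
  rcases eq_or_ne v 0 with rfl | hv
  · simp only [stableIsotopy_zero]
  obtain ⟨r, hr, θ, rfl⟩ := exists_eq_smul_sphere hv
  have hend : ∀ c, c = 0 ∨ c = 1 → cylinderHeight t r s = c →
      (f (θ, cylinderHeight t r s)).2 = c := fun c hc h => by rw [h, hf c hc]
  rw [stableIsotopy_smul f t s hr, stableIsotopy_smul g _ _ hr,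
    cylinderHeight_displace hr.le (hend 0 (Or.inl rfl)) (hend 1 (Or.inr rfl)), Prod.mk.eta, hgf,
    stableIsotopy_smul h t s hr]
  congr 1
  ring

theorem stableIsotopy_endpoint {c : unitInterval} (hc : c = 0 ∨ c = 1)
    (hf : ∀ θ, (f (θ, c)).2 = c) (x : EuclideanSpace ℝ (Fin n) × ℝ) :
    stableIsotopy f c x = (alexander (fun θ => (f (θ, c)).1) x.1, x.2) := by
  obtain ⟨v, s⟩ := x
  rcases eq_or_ne v 0 with rfl | hv
  · simp [stableIsotopy_zero, alexander]
  · obtain ⟨r, hr, θ, rfl⟩ := exists_eq_smul_sphere hv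
    rw [stableIsotopy_smul f c s hr, cylinderHeight_endpoint hc hr, hf, sub_self, mul_zero,
      add_zero, alexander_smul _ hr]

theorem norm_fst_stableIsotopy (f : UnitSphere n × unitInterval → UnitSphere n × unitInterval)
    (t : ℝ) (x : EuclideanSpace ℝ (Fin n) × ℝ) : ‖(stableIsotopy f t x).1‖ = ‖x.1‖ := by
  unfold stableIsotopy
  split_ifs with hv
  · rfl
  · simp [norm_smul]

theorem abs_snd_stableIsotopy_sub_le
    (f : UnitSphere n × unitInterval → UnitSphere n × unitInterval)
    (t : ℝ) (x : EuclideanSpace ℝ (Fin n) × ℝ) : |(stableIsotopy f t x).2 - x.2| ≤ ‖x.1‖ := by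
  unfold stableIsotopy
  split_ifs with hv
  · simp
  · rw [add_sub_cancel_left, abs_mul, abs_norm]
    refine mul_le_of_le_one_right (norm_nonneg _) ?_
    exact (abs_sub_le_of_nonneg_of_le unitInterval.nonneg' unitInterval.le_one'
      unitInterval.nonneg' unitInterval.le_one')

variable {M : Type*} [TopologicalSpace M] {b : M} {s : Set M}
  {F : M → UnitSphere n × unitInterval → UnitSphere n × unitInterval}

theorem continuousAt_stableIsotopy_zero (F : M → UnitSphere n × unitInterval →
    UnitSphere n × unitInterval) (b : M) (a t : ℝ) :
    ContinuousAt (fun z : M × (EuclideanSpace ℝ (Fin n) × ℝ) × ℝ =>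
      stableIsotopy (F z.1) z.2.2 z.2.1) (b, (0, a), t) := by
  have hnorm : Tendsto (fun z : M × (EuclideanSpace ℝ (Fin n) × ℝ) × ℝ => ‖z.2.1.1‖)
      (𝓝 (b, (0, a), t)) (𝓝 0) := by
    rw [← norm_zero (E := EuclideanSpace ℝ (Fin n))]
    exact Continuous.tendsto (by fun_prop) _
  have hsnd : Tendsto (fun z : M × (EuclideanSpace ℝ (Fin n) × ℝ) × ℝ => z.2.1.2)
      (𝓝 (b, (0, a), t)) (𝓝 a) := Continuous.tendsto (by fun_prop) _
  have hdiff : Tendsto (fun z : M × (EuclideanSpace ℝ (Fin n) × ℝ) × ℝ =>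
      (stableIsotopy (F z.1) z.2.2 z.2.1).2 - z.2.1.2) (𝓝 (b, (0, a), t)) (𝓝 0) :=
    squeeze_zero_norm (fun z => abs_snd_stableIsotopy_sub_le _ _ _) hnorm
  have hfst' : Tendsto (fun z : M × (EuclideanSpace ℝ (Fin n) × ℝ) × ℝ =>
      (stableIsotopy (F z.1) z.2.2 z.2.1).1) (𝓝 (b, (0, a), t)) (𝓝 0) :=
    squeeze_zero_norm (fun z => (norm_fst_stableIsotopy _ _ _).le) hnorm
  have hsnd' : Tendsto (fun z : M × (EuclideanSpace ℝ (Fin n) × ℝ) × ℝ =>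
      (stableIsotopy (F z.1) z.2.2 z.2.1).2) (𝓝 (b, (0, a), t)) (𝓝 a) := by
    simpa only [sub_add_cancel, zero_add] using hdiff.add hsnd
  change Tendsto _ _ (𝓝 (stableIsotopy (F b) t (0, a)))
  rw [stableIsotopy_zero]
  exact hfst'.prodMk_nhds hsnd'

theorem continuousOn_stableIsotopy_ne_zero
    (hF : ContinuousOn (fun z : M × UnitSphere n × unitInterval => F z.1 z.2) (s ×ˢ univ)) :
    ContinuousOn (fun z : M × (EuclideanSpace ℝ (Fin n) × ℝ) × ℝ =>
      stableIsotopy (F z.1) z.2.2 z.2.1) (s ×ˢ univ ∩ {z | z.2.1.1 ≠ 0}) := by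
  rw [continuousOn_iff_continuous_domRestrict]
  set A := s ×ˢ univ ∩ {z : M × (EuclideanSpace ℝ (Fin n) × ℝ) × ℝ | z.2.1.1 ≠ 0}
  have hnorm : Continuous fun z : A => ‖z.1.2.1.1‖ := by fun_prop
  have hrad : Continuous fun z : A => radial z.1.2.1.1 z.2.2 :=
    ((hnorm.inv₀ fun z => norm_ne_zero_iff.2 z.2.2).smul (by fun_prop)).subtype_mk _
  have hheight : Continuous fun z : A => cylinderHeight z.1.2.2 ‖z.1.2.1.1‖ z.1.2.1.2 :=
    continuous_iff_continuousAt.2 fun z =>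
      (continuousAt_cylinderHeight (norm_pos_iff.2 z.2.2)).comp (x := z)
        (f := fun z : A => (z.1.2.2, ‖z.1.2.1.1‖, z.1.2.1.2)) (by fun_prop)
  have hF' : Continuous fun z : A => F z.1.1
      (radial z.1.2.1.1 z.2.2, cylinderHeight z.1.2.2 ‖z.1.2.1.1‖ z.1.2.1.2) :=
    hF.comp_continuous (f := fun z : A => (z.1.1, radial z.1.2.1.1 z.2.2,
      cylinderHeight z.1.2.2 ‖z.1.2.1.1‖ z.1.2.1.2)) (by fun_prop) fun z => ⟨z.2.1.1, mem_univ _⟩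
  refine Continuous.congr ((hnorm.smul (continuous_subtype_val.comp hF'.fst)).prodMk
    (Continuous.add (f := fun z : A => z.1.2.1.2) (by fun_prop)
      (hnorm.mul ((continuous_subtype_val.comp hF'.snd).sub
        (continuous_subtype_val.comp hheight))))) fun z => ?_
  simp only [domRestrict_apply, stableIsotopy, dif_neg z.2.2]
  rfl

theorem continuousOn_stableIsotopy
    (hF : ContinuousOn (fun z : M × UnitSphere n × unitInterval => F z.1 z.2) (s ×ˢ univ)) :
    ContinuousOn (fun z : M × (EuclideanSpace ℝ (Fin n) × ℝ) × ℝ =>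
      stableIsotopy (F z.1) z.2.2 z.2.1) (s ×ˢ univ) := by
  rintro ⟨b, ⟨v, a⟩, t⟩ hz
  rcases eq_or_ne v 0 with rfl | hv
  · exact (continuousAt_stableIsotopy_zero F b a t).continuousWithinAt
  · have hopen : IsOpen {z : M × (EuclideanSpace ℝ (Fin n) × ℝ) × ℝ | z.2.1.1 ≠ 0} :=
      isOpen_ne_fun (by fun_prop) continuous_const
    rw [← continuousWithinAt_inter (hopen.mem_nhds hv)]
    exact continuousOn_stableIsotopy_ne_zero hF _ ⟨hz, hv⟩

end StableIsotopy

section IsotopyBundle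

variable {n : ℕ} {M W : Type*} [TopologicalSpace M] [TopologicalSpace W] {q : W → M}
  {e : M → Trivialization (UnitSphere n × unitInterval) q}

theorem preservesEnds_coordChange {bd₀ bd₁ : Set W} (h₀ : ∀ b, IsSlice (e b) bd₀ 0)
    (h₁ : ∀ b, IsSlice (e b) bd₁ 1) (i j : M) {b : M}
    (hb : b ∈ (e i).baseSet ∩ (e j).baseSet) :
    PreservesEnds ((e i).coordChange (e j) b) := by
  rintro c (rfl | rfl)
  · exact (h₀ i).coordChange_snd (h₀ j) hb
  · exact (h₁ i).coordChange_snd (h₁ j) hb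

/-- The bundle over `M` whose transition functions over the time axis `ℝ`, the last factor of the
fiber, are the stable isotopies given by the coordinate changes of an `Sⁿ⁻¹ × [0,1]`-bundle. -/
def isotopyCore (he : ∀ b, b ∈ (e b).baseSet)
    (hends : ∀ i j, ∀ {b}, b ∈ (e i).baseSet ∩ (e j).baseSet →
      PreservesEnds ((e i).coordChange (e j) b)) :
    FiberBundleCore M M ((EuclideanSpace ℝ (Fin n) × ℝ) × ℝ) where
  baseSet i := (e i).baseSet
  isOpen_baseSet i := (e i).open_baseSet
  indexAt := id
  mem_baseSet_at := he
  coordChange i j b x := (stableIsotopy ((e i).coordChange (e j) b) x.2 x.1, x.2)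
  coordChange_self i _ hb x := by
    rw [stableIsotopy_id ((e i).coordChange_same_apply hb)]
  continuousOn_coordChange i j :=
    (continuousOn_stableIsotopy (continuousOn_trivialization_coordChange (e i) (e j))).prodMk
      (by fun_prop)
  coordChange_comp i j k b hb x := by
    rw [stableIsotopy_comp (hends i j hb.1)
      ((e i).coordChange_coordChange (e j) (e k) hb.1.1 hb.1.2)]

variable {he : ∀ b, b ∈ (e b).baseSet}
  {hends : ∀ i j, ∀ {b}, b ∈ (e i).baseSet ∩ (e j).baseSet →
    PreservesEnds ((e i).coordChange (e j) b)}

/-- The time coordinate of a point of the bundle `isotopyCore`. -/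
def isotopyTime (y : (isotopyCore he hends).TotalSpace) : ℝ :=
  Prod.snd (α := EuclideanSpace ℝ (Fin n) × ℝ) y.2

theorem isotopyTime_localTriv (i : M) (y : (isotopyCore he hends).TotalSpace) :
    ((isotopyCore he hends).localTriv i y).2.2 = isotopyTime y :=
  rfl

theorem hasCocycle_isotopyTime (t : ℝ) :
    HasCocycle (fun y : {y : (isotopyCore he hends).TotalSpace | isotopyTime y = t} =>
        (isotopyCore he hends).proj y)
      (fun i => (e i).baseSet) fun i j b => stableIsotopy ((e i).coordChange (e j) b) t :=
  (hasCocycle_slice (e := (isotopyCore he hends).localTriv) he fun _ _ _ => Iff.rfl).congr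
    fun _ _ _ hb v => congrArg Prod.fst (localTriv_coordChange (isotopyCore he hends) hb (v, t))

theorem bundleIso_isotopyTime {E : Type*} [TopologicalSpace E] {p : E → M} {A : Set W}
    (hp : IsTopBundle (UnitSphere n) p) {c : unitInterval} (hc : c = 0 ∨ c = 1)
    (hA : ∀ b, IsSlice (e b) A c) (hAp : BundleIso (fun w : A => q w) p) :
    BundleIso (fun z : (inducedCore hp).TotalSpace × EuclideanSpace ℝ (Fin 1) =>
        inducedProj hp z.1)
      (fun y : {y : (isotopyCore he hends).TotalSpace | isotopyTime y = c} =>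
        (isotopyCore he hends).proj y) := by
  have hline : EuclideanSpace ℝ (Fin 1) ≃ₜ ℝ :=
    (EuclideanSpace.equiv (Fin 1) ℝ).toHomeomorph.trans (Homeomorph.funUnique (Fin 1) ℝ)
  have hinduced := (((hasCocycle_slice he hA).of_bundleIso hAp).inducedProj hp).prod ℝ
  have hlevel := (hasCocycle_isotopyTime (he := he) (hends := hends) c).congr
    fun i j b hb => stableIsotopy_endpoint hc ((hA i).coordChange_snd (hA j) hb)
  have hiso : BundleIso (inducedProj hp) (inducedProj hp) := ⟨Homeomorph.refl _, fun _ => rfl⟩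
  exact (hiso.prodCongr hline).trans (hinduced.bundleIso hlevel fun b => ⟨b, he b⟩)

end IsotopyBundle

end


theorem proposition4p2_general (n : ℕ) {M E₀ E₁ : Type*} [TopologicalSpace M] [NormalSpace M]
    [ParacompactSpace M] [TopologicalSpace E₀] [TopologicalSpace E₁]
    (p₀ : E₀ → M) (p₁ : E₁ → M)
    (h₀ : IsTopBundle (UnitSphere n) p₀) (h₁ : IsTopBundle (UnitSphere n) p₁)
    (hbord : FiberwiseBordant (UnitSphere n) p₀ p₁) :
    BundleIso
      (fun z : (inducedCore h₀).TotalSpace × EuclideanSpace ℝ (Fin 1) => inducedProj h₀ z.1)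
      (fun z : (inducedCore h₁).TotalSpace × EuclideanSpace ℝ (Fin 1) => inducedProj h₁ z.1) := by
  obtain ⟨W, _, q, bd₀, bd₁, hcharts, hbd₀, hbd₁⟩ := hbord
  choose e he hslice using hcharts
  have hslice₀ : ∀ b, IsSlice (e b) bd₀ 0 := fun b w hw => (hslice b w hw).1
  have hslice₁ : ∀ b, IsSlice (e b) bd₁ 1 := fun b w hw => (hslice b w hw).2
  have hends := fun i j {b} => preservesEnds_coordChange hslice₀ hslice₁ i j (b := b)
  let Z := isotopyCore he hends
  have hend₀ := bundleIso_isotopyTime (he := he) (hends := hends) h₀ (Or.inl rfl) hslice₀ hbd₀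
  have hend₁ := bundleIso_isotopyTime (he := he) (hends := hends) h₁ (Or.inr rfl) hslice₁ hbd₁
  have hlevels := bundleIso_levelSet (p := Z.proj) (t := isotopyTime)
    (fun b => ⟨Z.localTriv b, he b, fun y _ => isotopyTime_localTriv b y⟩)
    ((0 : unitInterval) : ℝ) ((1 : unitInterval) : ℝ)
  exact hend₀.trans (hlevels.trans hend₁.symm)

theorem proposition4p2 (n : ℕ) {M E₀ E₁ : Type*} [TopologicalSpace M] [T2Space M]
    [ParacompactSpace M] [TopologicalSpace E₀] [TopologicalSpace E₁]
    (p₀ : E₀ → M) (p₁ : E₁ → M)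
    (h₀ : IsTopBundle (UnitSphere n) p₀) (h₁ : IsTopBundle (UnitSphere n) p₁)
    (hbord : FiberwiseBordant (UnitSphere n) p₀ p₁) :
    StablyIsomorphic (inducedProj h₀) (inducedProj h₁) :=
  ⟨1, proposition4p2_general n p₀ p₁ h₀ h₁ hbord⟩
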